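/- Let $L\ge 1$, let $2=r_1>r_2>\dots>r_{L+1}=1$, let $\mu_1,\dots,\mu_L$ and $\epsilon_1,\dots,\epsilon_L$ be positive numbers, and set $\mu_0=\epsilon_0=1$ (permeabilities and permittivities of a layered structure surrounding the perfectly conducting ball $|x|<1$; layer $j$ is $r_{j+1}\le|x|<r_j$). For a frequency $t>0$ put $k_j=t\sqrt{\epsilon_j\mu_j}$. Let $j_n$ and $y_n$ be the spherical Bessel functions of the first and second kind, $h_n=j_n+iy_n$ the spherical Hankel function of the first kind, $\mathcal J_n(s)=j_n(s)+s\,j_n'(s)$ and $\mathcal H_n(s)=h_n(s)+s\,h_n'(s)$. Let $p_{n,2}^{TE}(t)$ and $p_{n,2}^{TM}(t)$ be the entries in the first row and second column of $$P_n^{TE}(t)=(-it)^L\Big(\prod_{j=1}^L\mu_j^{3/2}\epsilon_j^{1/2}r_j\Big)\begin{bmatrix} j_n(k_L)&h_n(k_L)\\0&0\end{bmatrix}M^{TE}_L M^{TE}_{L-1}\cdots M^{TE}_1,$$ $$P_n^{TM}(t)=(it)^L\Big(\prod_{j=1}^L\mu_j^{1/2}\epsilon_j^{3/2}r_j\Big)\begin{bmatrix}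 \mathcal J_n(k_L)&\mathcal H_n(k_L)\\0&0\end{bmatrix}M^{TM}_L M^{TM}_{L-1}\cdots M^{TM}_1,$$ where $$M^{TE}_j=\begin{bmatrix}\frac1{\mu_j}\mathcal H_n(k_jr_j)&-h_n(k_jr_j)\\-\frac1{\mu_j}\mathcal J_n(k_jr_j)&j_n(k_jr_j)\end{bmatrix}\begin{bmatrix}j_n(k_{j-1}r_j)&h_n(k_{j-1}r_j)\\\frac1{\mu_{j-1}}\mathcal J_n(k_{j-1}r_j)&\frac1{\mu_{j-1}}\mathcal H_n(k_{j-1}r_j)\end{bmatrix},$$ $$M^{TM}_j=\begin{bmatrix}h_n(k_jr_j)&-\frac1{\epsilon_j}\mathcal H_n(k_jr_j)\\-j_n(k_jr_j)&\frac1{\epsilon_j}\mathcal J_n(k_jr_j)\end{bmatrix}\begin{bmatrix}\frac1{\epsilon_{j-1}}\mathcal J_n(k_{j-1}r_j)&\frac1{\epsilon_{j-1}}\mathcal H_n(k_{j-1}r_j)\\j_n(k_{j-1}r_j)&h_n(k_{j-1}r_j)\end{bmatrix}.$$ Then for every $n\ge1$ and for each of the two polarizations $T\in\{TE,TM\}$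 the leading low-frequency coefficient $g_{n,0}^{T}$ of $p_{n,2}^{T}$ exists and is nonzero. That is, there is a number $g_{n,0}^{T}$ with $p_{n,2}^{T}(t)=t^{-n-1}\big(g_{n,0}^{T}+o(1)\big)$ as $t\to0^+$; and whenever, for some $N\ge n$ and complex numbers $g_{n,0}^T,\dots,g_{n,N-n}^T$, $$p_{n,2}^{T}(t)=t^{-n-1}\Big(\sum_{l=0}^{N-n}g_{n,l}^{T}\,t^{2l}+o(t^{2N-2n})\Big)\qquad(t\to0^+),$$ one has $g_{n,0}^{T}\ne0$. -/

import Mathlib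

open Filter Topology Asymptotics
open scoped Nat

noncomputable section

/-- Spherical Bessel function of the first kind
`j_n(t) = ∑ (-1)^l t^(n+2l) / (2^l l! · 1·3⋯(2n+2l+1))`. -/
def sphJ (n : ℕ) (t : ℝ) : ℝ :=
  ∑' l : ℕ, (-1) ^ l * t ^ (n + 2 * l) / (2 ^ l * (l ! : ℝ) * ((2 * n + 2 * l + 1)‼ : ℝ))

/-- Spherical Bessel function of the second kind
`y_n(t) = -(2n)!/(2^n n!) ∑ (-1)^l t^(2l-n-1) / (2^l l! (-2n+1)(-2n+3)⋯(-2n+2l-1))`. -/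
def sphY (n : ℕ) (t : ℝ) : ℝ :=
  -(((2 * n)! : ℝ) / (2 ^ n * (n ! : ℝ))) *
    ∑' l : ℕ, (-1) ^ l * t ^ (2 * (l : ℤ) - (n : ℤ) - 1) /
      (2 ^ l * (l ! : ℝ) * ∏ i ∈ Finset.range l, (-2 * (n : ℝ) + 2 * (i : ℝ) + 1))

/-- Spherical Hankel function of the first kind, `h_n^{(1)} = j_n + i y_n`. -/
def sphH (n : ℕ) (t : ℝ) : ℂ := (sphJ n t : ℂ) + Complex.I * (sphY n t : ℂ)

/-- `𝒥_n(t) = j_n(t) + t j_n'(t)`. -/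
def calJ (n : ℕ) (t : ℝ) : ℝ := sphJ n t + t * deriv (sphJ n) t

/-- `ℋ_n(t) = h_n^{(1)}(t) + t (h_n^{(1)})'(t)`. -/
def calH (n : ℕ) (t : ℝ) : ℂ := sphH n t + (t : ℂ) * deriv (sphH n) t

/-- A layered medium with `L` layers: `2 = r_1 > r_2 > ⋯ > r_{L+1} = 1`, the layer
`r_{j+1} ≤ |x| < r_j` (`1 ≤ j ≤ L`) has permeability `μ_j > 0` and permittivity `ε_j > 0`,
and the exterior `|x| > 2` has `μ_0 = ε_0 = 1`. The core `|x| < 1` is perfectly conducting.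
Only the values `r 1, …, r (L+1)` and `μ 0, …, μ L`, `ε 0, …, ε L` matter. -/
structure IsLayered (L : ℕ) (r μ ε : ℕ → ℝ) : Prop where
  r_one : r 1 = 2
  r_last : r (L + 1) = 1
  r_lt : ∀ j, 1 ≤ j → j ≤ L → r (j + 1) < r j
  mu_zero : μ 0 = 1
  eps_zero : ε 0 = 1
  mu_pos : ∀ j, 1 ≤ j → j ≤ L → 0 < μ j
  eps_pos : ∀ j, 1 ≤ j → j ≤ L → 0 < ε j

/-- Wave number `k_j = t √(ε_j μ_j)` of layer `j` at frequency `t`. -/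
def waveNum (μ ε : ℕ → ℝ) (t : ℝ) (j : ℕ) : ℝ := t * √(ε j * μ j)

/-- The product of the two matrices attached to the interface `|x| = r_j` in `P_n^{TE}`. -/
def interfaceTE (n : ℕ) (r μ ε : ℕ → ℝ) (t : ℝ) (j : ℕ) : Matrix (Fin 2) (Fin 2) ℂ :=
  let x : ℝ := waveNum μ ε t j * r j
  let y : ℝ := waveNum μ ε t (j - 1) * r j
  !![calH n x / (μ j : ℂ), -sphH n x;
     -((calJ n x : ℂ) / (μ j : ℂ)), (sphJ n x : ℂ)] *
  !![(sphJ n y : ℂ), sphH n y;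
     (calJ n y : ℂ) / (μ (j - 1) : ℂ), calH n y / (μ (j - 1) : ℂ)]

/-- The product of the two matrices attached to the interface `|x| = r_j` in `P_n^{TM}`. -/
def interfaceTM (n : ℕ) (r μ ε : ℕ → ℝ) (t : ℝ) (j : ℕ) : Matrix (Fin 2) (Fin 2) ℂ :=
  let x : ℝ := waveNum μ ε t j * r j
  let y : ℝ := waveNum μ ε t (j - 1) * r j
  !![sphH n x, -(calH n x / (ε j : ℂ));
     -(sphJ n x : ℂ), (calJ n x : ℂ) / (ε j : ℂ)] *
  !![(calJ n y : ℂ) / (ε (j - 1) : ℂ), calH n y / (ε (j - 1) : ℂ);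
     (sphJ n y : ℂ), sphH n y]

/-- Ordered product `M_L * M_{L-1} * ⋯ * M_1`. -/
def orderedProd (M : ℕ → Matrix (Fin 2) (Fin 2) ℂ) : ℕ → Matrix (Fin 2) (Fin 2) ℂ
  | 0 => 1
  | j + 1 => M (j + 1) * orderedProd M j

/-- The matrix `P_n^{TE}[ε, μ, t]`. -/
def PTE (n L : ℕ) (r μ ε : ℕ → ℝ) (t : ℝ) : Matrix (Fin 2) (Fin 2) ℂ :=
  ((-Complex.I * (t : ℂ)) ^ L *
      ((∏ j ∈ Finset.Icc 1 L, μ j ^ (3 / 2 : ℝ) * ε j ^ (1 / 2 : ℝ) * r j : ℝ) : ℂ)) •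
    (!![(sphJ n (waveNum μ ε t L) : ℂ), sphH n (waveNum μ ε t L); 0, 0] *
      orderedProd (interfaceTE n r μ ε t) L)

/-- The matrix `P_n^{TM}[ε, μ, t]`. -/
def PTM (n L : ℕ) (r μ ε : ℕ → ℝ) (t : ℝ) : Matrix (Fin 2) (Fin 2) ℂ :=
  ((Complex.I * (t : ℂ)) ^ L *
      ((∏ j ∈ Finset.Icc 1 L, μ j ^ (1 / 2 : ℝ) * ε j ^ (3 / 2 : ℝ) * r j : ℝ) : ℂ)) •
    (!![(calJ n (waveNum μ ε t L) : ℂ), calH n (waveNum μ ε t L); 0, 0] *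
      orderedProd (interfaceTM n r μ ε t) L)

/-- `p_{n,2}^{TE}`, the entry of `P_n^{TE}` in the first row and second column. -/
def pTE2 (n L : ℕ) (r μ ε : ℕ → ℝ) (t : ℝ) : ℂ := PTE n L r μ ε t 0 1

/-- `p_{n,2}^{TM}`, the entry of `P_n^{TM}` in the first row and second column. -/
def pTM2 (n L : ℕ) (r μ ε : ℕ → ℝ) (t : ℝ) : ℂ := PTM n L r μ ε t 0 1

/-- The low-frequency expansion of order `N ≥ n`,
`p(t) = t^(-n-1) (∑_{l=0}^{N-n} g_l t^(2l) + o(t^(2N-2n)))` as `t → 0+`. -/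
def HasLowFreqExpansion (n N : ℕ) (p : ℝ → ℂ) (g : ℕ → ℂ) : Prop :=
  (fun t : ℝ => (t : ℂ) ^ (n + 1) * p t -
      ∑ l ∈ Finset.range (N - n + 1), g l * (t : ℂ) ^ (2 * l))
    =o[𝓝[>] 0] fun t : ℝ => t ^ (2 * (N - n))

end

/-! Each interface matrix factors as `Q_j R_{j-1}`: `R_{j-1}` takes the traces at `r_j` from
outside, `Q_j` is the adjugate of the trace matrix from inside. The row defining `p_{n,2}` is, up to
a constant, the first row of `R_L` at `r_{L+1} = 1`, so the product regroups as `(R_L Q_L) ⋯ (R_1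
Q_1) R_0`, with one transfer matrix per layer.

In `R_j Q_j` the products of two `j`-type or two `y`-type functions cancel, leaving `i` times real
cross products. Multiplied by `∓it`, these converge to a real matrix of signs `[+ -; - +]`
(`exists_crossProduct_limits`, `exists_tendsto_transferTE`). Such matrices preserve the cone of
vectors of signs `(+, -)`. The second column of `R_0`, scaled by `t^(n+1)`, tends to a unimodular
multiple of such a vector for TE, and likewise for TM (`exists_tendsto_hankel`). Hence no
cancellation occurs through any number of layers (`tendstoAlternating_orderedProd`), and the first
component has a nonzero limit. -/

/-! ### Low-frequency asymptotics of spherical Bessel functions -/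

/-- A power series on `ℝ` with bounded coefficients is analytic at the origin. -/
theorem analyticAt_tsum_of_bounded {c : ℕ → ℝ} (hc : ∀ l, |c l| ≤ 1) :
    AnalyticAt ℝ (fun u : ℝ => ∑' l : ℕ, c l * u ^ l) 0 := by
  have hr : (1 : ENNReal) ≤ (FormalMultilinearSeries.ofScalars ℝ c).radius := by
    refine FormalMultilinearSeries.le_radius_of_bound _ 1 (r := 1) fun l => ?_
    rw [FormalMultilinearSeries.ofScalars_norm]
    simpa using hc l
  have h := (FormalMultilinearSeries.hasFPowerSeriesOnBall _
    (lt_of_lt_of_le one_pos hr)).analyticAt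
  refine h.congr (Eventually.of_forall fun u => ?_)
  simp only [FormalMultilinearSeries.sum]
  refine tsum_congr fun l => ?_
  simp [mul_comm]

/-- For `Φ` analytic at `0`, the derivative of `s ↦ s ^ m Φ(s²)` near `0⁺`. -/
theorem eventually_hasDerivAt_zpow_mul_comp_sq {Φ f : ℝ → ℝ} (hΦ : AnalyticAt ℝ Φ 0) (m : ℤ)
    (hf : ∀ s, 0 < s → f s = s ^ m * Φ (s ^ 2)) :
    ∀ᶠ s in 𝓝[>] (0 : ℝ),
      HasDerivAt f (m * s ^ (m - 1) * Φ (s ^ 2) + s ^ m * (deriv Φ (s ^ 2) * (2 * s))) s := by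
  have hsq : Tendsto (fun s : ℝ => s ^ 2) (𝓝[>] 0) (𝓝 0) := by
    have : Tendsto (fun s : ℝ => s ^ 2) (𝓝 0) (𝓝 (0 ^ 2)) := (continuous_pow 2).tendsto 0
    simpa using this.mono_left nhdsWithin_le_nhds
  filter_upwards [hsq.eventually hΦ.eventually_analyticAt, self_mem_nhdsWithin] with s hs hs0
  have hs0 : 0 < s := hs0
  have h1 : HasDerivAt (fun x : ℝ => Φ (x ^ 2)) (deriv Φ (s ^ 2) * (2 * s)) s := by
    have h2 : HasDerivAt (fun x : ℝ => x ^ 2) (2 * s) s := by simpa using hasDerivAt_pow 2 s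
    exact HasDerivAt.comp s hs.differentiableAt.hasDerivAt h2
  refine ((hasDerivAt_zpow m s (Or.inl hs0.ne')).mul h1).congr_of_eventuallyEq ?_
  filter_upwards [eventually_gt_nhds hs0] with x hx using hf x hx

theorem tendsto_zpow_neg_mul {Φ f : ℝ → ℝ} (hΦ : AnalyticAt ℝ Φ 0) (m : ℤ)
    (hf : ∀ s, 0 < s → f s = s ^ m * Φ (s ^ 2)) :
    Tendsto (fun s => s ^ (-m) * f s) (𝓝[>] 0) (𝓝 (Φ 0)) := by
  have hsq : Tendsto (fun s : ℝ => s ^ 2) (𝓝[>] 0) (𝓝 0) := by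
    have : Tendsto (fun s : ℝ => s ^ 2) (𝓝 0) (𝓝 (0 ^ 2)) := (continuous_pow 2).tendsto 0
    simpa using this.mono_left nhdsWithin_le_nhds
  refine (hΦ.continuousAt.tendsto.comp hsq).congr' ?_
  filter_upwards [self_mem_nhdsWithin] with s hs0
  have hs0 : 0 < s := hs0
  have : s ^ m ≠ 0 := zpow_ne_zero _ hs0.ne'
  simp only [Function.comp, hf s hs0, zpow_neg]
  field_simp

/-- The rescaled quantity equals `(m + 1) Φ(s²) + 2 s² Φ'(s²)` near `0⁺`, and the second term
vanishes in the limit. -/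
theorem tendsto_zpow_neg_mul_add_deriv {Φ f : ℝ → ℝ} (hΦ : AnalyticAt ℝ Φ 0) (m : ℤ)
    (hf : ∀ s, 0 < s → f s = s ^ m * Φ (s ^ 2)) :
    Tendsto (fun s => s ^ (-m) * (f s + s * deriv f s)) (𝓝[>] 0) (𝓝 ((m + 1) * Φ 0)) := by
  have hid : Tendsto (fun s : ℝ => s) (𝓝[>] 0) (𝓝 0) := nhdsWithin_le_nhds
  have hsq : Tendsto (fun s : ℝ => s ^ 2) (𝓝[>] 0) (𝓝 0) := by simpa using hid.pow 2
  have h0 := hΦ.continuousAt.tendsto.comp hsq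
  have h1 := hΦ.deriv.continuousAt.tendsto.comp hsq
  have h := (h0.const_mul ((m : ℝ) + 1)).add ((h1.mul hsq).const_mul 2)
  simp only [mul_zero, add_zero] at h
  refine h.congr' ?_
  filter_upwards [self_mem_nhdsWithin, eventually_hasDerivAt_zpow_mul_comp_sq hΦ m hf]
    with s hs0 hd
  have hs0 : 0 < s := hs0
  have : s ^ m ≠ 0 := zpow_ne_zero _ hs0.ne'
  rw [hd.deriv, hf s hs0, zpow_neg, zpow_sub_one₀ hs0.ne']
  simp only [Function.comp]
  field_simp
  ring

/-- `y_n(s) + s y_n'(s)`, so that `ℋ_n = 𝒥_n + i 𝒴_n`. -/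
noncomputable def calY (n : ℕ) (t : ℝ) : ℝ := sphY n t + t * deriv (sphY n) t

theorem exists_sphJ_eq (n : ℕ) : ∃ Φ : ℝ → ℝ, AnalyticAt ℝ Φ 0 ∧ 0 < Φ 0 ∧
    ∀ s, 0 < s → sphJ n s = s ^ (n : ℤ) * Φ (s ^ 2) := by
  refine ⟨fun u => ∑' l : ℕ, ((-1) ^ l / (2 ^ l * (l ! : ℝ) * ((2 * n + 2 * l + 1)‼ : ℝ))) * u ^ l,
    analyticAt_tsum_of_bounded fun l => ?_, ?_, fun s hs => ?_⟩
  · have h2 : (1 : ℝ) ≤ 2 ^ l := one_le_pow₀ (by norm_num)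
    have h3 : (1 : ℝ) ≤ (l ! : ℝ) := by exact_mod_cast Nat.factorial_pos l
    have h4 : (1 : ℝ) ≤ ((2 * n + 2 * l + 1)‼ : ℝ) := by
      exact_mod_cast Nat.doubleFactorial_pos _
    have h5 := one_le_mul_of_one_le_of_one_le (one_le_mul_of_one_le_of_one_le h2 h3) h4
    rw [abs_div, abs_pow, abs_neg, abs_one, one_pow, abs_of_pos (lt_of_lt_of_le one_pos h5)]
    exact div_le_one_of_le₀ h5 (by linarith)
  · beta_reduce
    rw [tsum_eq_single 0 (fun l hl => by simp [hl])]
    simpa using Nat.doubleFactorial_pos _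
  · simp only [sphJ]
    rw [← tsum_mul_left]
    refine tsum_congr fun l => ?_
    rw [zpow_natCast, pow_add, pow_mul]
    ring

theorem exists_sphY_eq (n : ℕ) : ∃ Ψ : ℝ → ℝ, AnalyticAt ℝ Ψ 0 ∧ Ψ 0 < 0 ∧
    ∀ s, 0 < s → sphY n s = s ^ (-((n : ℤ) + 1)) * Ψ (s ^ 2) := by
  refine ⟨fun u => -(((2 * n)! : ℝ) / (2 ^ n * (n ! : ℝ))) * ∑' l : ℕ, ((-1) ^ l /
      (2 ^ l * (l ! : ℝ) * ∏ i ∈ Finset.range l, (-2 * (n : ℝ) + 2 * (i : ℝ) + 1))) * u ^ l,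
    analyticAt_const.mul (analyticAt_tsum_of_bounded fun l => ?_), ?_, fun s hs => ?_⟩
  · have h2 : (1 : ℝ) ≤ 2 ^ l := one_le_pow₀ (by norm_num)
    have h3 : (1 : ℝ) ≤ (l ! : ℝ) := by exact_mod_cast Nat.factorial_pos l
    have h4 : (1 : ℝ) ≤ |∏ i ∈ Finset.range l, (-2 * (n : ℝ) + 2 * (i : ℝ) + 1)| := by
      rw [Finset.abs_prod]
      refine Finset.prod_induction _ (fun x : ℝ => 1 ≤ x)
        (fun _ _ => one_le_mul_of_one_le_of_one_le) le_rfl fun i _ => ?_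
      -- Each factor is an odd integer, hence nonzero.
      have : (1 : ℤ) ≤ |-2 * (n : ℤ) + 2 * (i : ℤ) + 1| := Int.one_le_abs (by omega)
      exact_mod_cast this
    have h5 := one_le_mul_of_one_le_of_one_le (one_le_mul_of_one_le_of_one_le h2 h3) h4
    rw [abs_div, abs_pow, abs_neg, abs_one, one_pow, abs_mul,
      abs_of_pos (show (0 : ℝ) < 2 ^ l * (l ! : ℝ) by positivity)]
    exact div_le_one_of_le₀ h5 (by linarith)
  · beta_reduce
    rw [tsum_eq_single 0 (fun l hl => by simp [hl])]
    have : (0 : ℝ) < ((2 * n)! : ℝ) / (2 ^ n * (n ! : ℝ)) := by positivity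
    simpa using this
  · simp only [sphY]
    rw [mul_left_comm]
    congr 1
    rw [← tsum_mul_left]
    refine tsum_congr fun l => ?_
    rw [show 2 * (l : ℤ) - (n : ℤ) - 1 = -((n : ℤ) + 1) + ((2 * l : ℕ) : ℤ) by push_cast; ring,
      zpow_add₀ hs.ne', zpow_natCast, pow_mul]
    ring

/-- Leading behaviour at `0⁺` of `j_n`, `𝒥_n`, `y_n` and `𝒴_n`. -/
theorem exists_bessel_limits (n : ℕ) : ∃ a b : ℝ, 0 < a ∧ 0 < b ∧
    Tendsto (fun s => s ^ (-(n : ℤ)) * sphJ n s) (𝓝[>] 0) (𝓝 a) ∧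
    Tendsto (fun s => s ^ (-(n : ℤ)) * calJ n s) (𝓝[>] 0) (𝓝 ((n + 1) * a)) ∧
    Tendsto (fun s => s ^ ((n : ℤ) + 1) * sphY n s) (𝓝[>] 0) (𝓝 (-b)) ∧
    Tendsto (fun s => s ^ ((n : ℤ) + 1) * calY n s) (𝓝[>] 0) (𝓝 (n * b)) := by
  obtain ⟨Φ, hΦ, hΦ0, hJ⟩ := exists_sphJ_eq n
  obtain ⟨Ψ, hΨ, hΨ0, hY⟩ := exists_sphY_eq n
  refine ⟨Φ 0, -Ψ 0, hΦ0, neg_pos.2 hΨ0, tendsto_zpow_neg_mul hΦ _ hJ, ?_, ?_, ?_⟩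
  · simpa [calJ] using tendsto_zpow_neg_mul_add_deriv hΦ _ hJ
  · simpa using tendsto_zpow_neg_mul hΨ _ hY
  · have h := tendsto_zpow_neg_mul_add_deriv hΨ _ hY
    simp only [neg_neg] at h
    -- With `m = -(n + 1)` the factor `m + 1` is `-n`, so `𝒴_n` has the sign opposite to `y_n` when
    -- `n ≥ 1`.
    rw [show (n : ℝ) * -Ψ 0 = (((-((n : ℤ) + 1) : ℤ) : ℝ) + 1) * Ψ 0 by push_cast; ring]
    exact h

/-- Splitting the derivative of `h_n` needs differentiability of `j_n` and `y_n`, which the analytic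
factorizations give near `0⁺`. -/
theorem eventually_calH_eq (n : ℕ) :
    ∀ᶠ s in 𝓝[>] (0 : ℝ), calH n s = (calJ n s : ℂ) + Complex.I * (calY n s : ℂ) := by
  obtain ⟨Φ, hΦ, -, hJ⟩ := exists_sphJ_eq n
  obtain ⟨Ψ, hΨ, -, hY⟩ := exists_sphY_eq n
  filter_upwards [eventually_hasDerivAt_zpow_mul_comp_sq hΦ _ hJ,
    eventually_hasDerivAt_zpow_mul_comp_sq hΨ _ hY] with s h1 h2
  have h3 := (h1.differentiableAt.hasDerivAt.ofReal_comp).add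
    ((h2.differentiableAt.hasDerivAt.ofReal_comp).const_mul Complex.I)
  have h4 : deriv (sphH n) s = _ := h3.deriv
  rw [calH, h4, sphH, calJ, calY]
  push_cast
  ring

theorem tendsto_mul_const_nhdsGT_zero {ξ : ℝ} (hξ : 0 < ξ) :
    Tendsto (fun t : ℝ => t * ξ) (𝓝[>] 0) (𝓝[>] 0) := by
  refine tendsto_nhdsWithin_iff.2 ⟨?_, ?_⟩
  · have : Tendsto (fun t : ℝ => t * ξ) (𝓝 0) (𝓝 (0 * ξ)) := (continuous_mul_const ξ).tendsto 0
    simpa using this.mono_left nhdsWithin_le_nhds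
  · filter_upwards [self_mem_nhdsWithin] with t ht using mul_pos ht hξ

/-- If `f ∼ A sⁿ` and `g ∼ B s⁻ⁿ⁻¹` at `0⁺`, then `t f(tζ) g(tξ)` has a limit. -/
theorem tendsto_mul_mul_of_reciprocal_orders {n : ℕ} {f g : ℝ → ℝ} {A B ζ ξ : ℝ}
    (hζ : 0 < ζ) (hξ : 0 < ξ)
    (hf : Tendsto (fun s => s ^ (-(n : ℤ)) * f s) (𝓝[>] 0) (𝓝 A))
    (hg : Tendsto (fun s => s ^ ((n : ℤ) + 1) * g s) (𝓝[>] 0) (𝓝 B)) :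
    Tendsto (fun t => t * (f (t * ζ) * g (t * ξ))) (𝓝[>] 0)
      (𝓝 (A * B * (ζ ^ n / ξ ^ (n + 1)))) := by
  refine (((hf.comp (tendsto_mul_const_nhdsGT_zero hζ)).mul
    (hg.comp (tendsto_mul_const_nhdsGT_zero hξ))).mul_const _).congr' ?_
  filter_upwards [self_mem_nhdsWithin] with t ht
  have ht : 0 < t := ht
  simp only [Function.comp, zpow_neg, zpow_natCast]
  rw [show (n : ℤ) + 1 = ((n + 1 : ℕ) : ℤ) by push_cast; rfl, zpow_natCast, mul_pow, mul_pow]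
  field_simp
  ring

/-- Limits of the four cross products of Bessel functions that make up a transfer matrix. -/
theorem exists_crossProduct_limits {n : ℕ} (hn : 1 ≤ n) {ζ ξ : ℝ} (hζ : 0 < ζ) (hζξ : ζ < ξ) :
    ∃ p q u v : ℝ, 0 < p ∧ q < 0 ∧ u < 0 ∧ 0 < v ∧
    Tendsto (fun t => t * (sphJ n (t * ζ) * calY n (t * ξ) - sphY n (t * ζ) * calJ n (t * ξ)))
      (𝓝[>] 0) (𝓝 p) ∧
    Tendsto (fun t => t * (sphY n (t * ζ) * sphJ n (t * ξ) - sphJ n (t * ζ) * sphY n (t * ξ)))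
      (𝓝[>] 0) (𝓝 q) ∧
    Tendsto (fun t => t * (calJ n (t * ζ) * calY n (t * ξ) - calY n (t * ζ) * calJ n (t * ξ)))
      (𝓝[>] 0) (𝓝 u) ∧
    Tendsto (fun t => t * (calY n (t * ζ) * sphJ n (t * ξ) - calJ n (t * ζ) * sphY n (t * ξ)))
      (𝓝[>] 0) (𝓝 v) := by
  obtain ⟨a, b, ha, hb, hj, hJ, hy, hY⟩ := exists_bessel_limits n
  have hξ : 0 < ξ := hζ.trans hζξ
  have hn0 : (0 : ℝ) < n := by exact_mod_cast hn
  have hX : 0 < ζ ^ n / ξ ^ (n + 1) := by positivity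
  -- The layer has positive thickness; this strictness fixes the signs of `q` and `u`.
  have hlt : ζ ^ n / ξ ^ (n + 1) < ξ ^ n / ζ ^ (n + 1) := by
    gcongr
  set X := ζ ^ n / ξ ^ (n + 1)
  set Z := ξ ^ n / ζ ^ (n + 1)
  have hZ : 0 < Z := hX.trans hlt
  have hab : 0 < a * b := mul_pos ha hb
  refine ⟨_, _, _, _, ?_, ?_, ?_, ?_,
    ((tendsto_mul_mul_of_reciprocal_orders hζ hξ hj hY).sub
      (tendsto_mul_mul_of_reciprocal_orders hξ hζ hJ hy)).congr fun t => by ring,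
    ((tendsto_mul_mul_of_reciprocal_orders hξ hζ hj hy).sub
      (tendsto_mul_mul_of_reciprocal_orders hζ hξ hj hy)).congr fun t => by ring,
    ((tendsto_mul_mul_of_reciprocal_orders hζ hξ hJ hY).sub
      (tendsto_mul_mul_of_reciprocal_orders hξ hζ hJ hY)).congr fun t => by ring,
    ((tendsto_mul_mul_of_reciprocal_orders hξ hζ hj hY).sub
      (tendsto_mul_mul_of_reciprocal_orders hζ hξ hJ hy)).congr fun t => by ring⟩
  · have : 0 < a * b * (n * X + (n + 1) * Z) := by positivity
    linarith
  · have : a * b * (X - Z) < 0 := mul_neg_of_pos_of_neg hab (by linarith)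
    linarith
  · have : a * b * (n * (n + 1)) * (X - Z) < 0 :=
      mul_neg_of_pos_of_neg (by positivity) (by linarith)
    linarith
  · have : 0 < a * b * (n * Z + (n + 1) * X) := by positivity
    linarith

/-! ### Sign patterns and transfer matrices -/

/-- Real `2 × 2` matrices with sign pattern `[+ -; - +]`. -/
def IsCheckered (A : Matrix (Fin 2) (Fin 2) ℝ) : Prop :=
  0 < A 0 0 ∧ A 0 1 < 0 ∧ A 1 0 < 0 ∧ 0 < A 1 1

/-- The family of complex vectors `w t` converges at `0⁺` to a complex multiple `c` of a real
vector with sign pattern `(+, -)`. -/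
def TendstoAlternating (c : ℂ) (w : ℝ → Fin 2 → ℂ) : Prop :=
  ∃ v : Fin 2 → ℝ, 0 < v 0 ∧ v 1 < 0 ∧ ∀ i, Tendsto (fun t => w t i) (𝓝[>] 0) (𝓝 (c * v i))

/-- Conjugation by `diag(1, -1)` turns the matrix and the vector into entrywise positive ones, so
nothing cancels in the limit. -/
theorem TendstoAlternating.mulVec {c : ℂ} {w : ℝ → Fin 2 → ℂ} (hw : TendstoAlternating c w)
    {T : ℝ → Matrix (Fin 2) (Fin 2) ℂ} {A : Matrix (Fin 2) (Fin 2) ℝ} (hA : IsCheckered A)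
    (hT : ∀ i k, Tendsto (fun t => T t i k) (𝓝[>] 0) (𝓝 (A i k))) :
    TendstoAlternating c (fun t => (T t).mulVec (w t)) := by
  obtain ⟨v, hv0, hv1, hv⟩ := hw
  obtain ⟨h00, h01, h10, h11⟩ := hA
  refine ⟨A.mulVec v, ?_, ?_, fun i => ?_⟩
  · simp only [Matrix.mulVec, dotProduct, Fin.sum_univ_two]
    have := mul_pos h00 hv0
    have := mul_pos_of_neg_of_neg h01 hv1
    linarith
  · simp only [Matrix.mulVec, dotProduct, Fin.sum_univ_two]
    have := mul_neg_of_neg_of_pos h10 hv0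
    have := mul_neg_of_pos_of_neg h11 hv1
    linarith
  · simp only [Matrix.mulVec, dotProduct, Fin.sum_univ_two]
    have h := ((hT i 0).mul (hv 0)).add ((hT i 1).mul (hv 1))
    convert h using 2
    push_cast
    ring

/-- Tangential traces of the `TE` modes `j_n`, `h_n` at the argument `s`. -/
noncomputable def traceTE (n : ℕ) (m s : ℝ) : Matrix (Fin 2) (Fin 2) ℂ :=
  !![(sphJ n s : ℂ), sphH n s; (calJ n s : ℂ) / (m : ℂ), calH n s / (m : ℂ)]

/-- The adjugate of `traceTE`. -/
noncomputable def adjTraceTE (n : ℕ) (m s : ℝ) : Matrix (Fin 2) (Fin 2) ℂ :=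
  !![calH n s / (m : ℂ), -sphH n s; -((calJ n s : ℂ) / (m : ℂ)), (sphJ n s : ℂ)]

/-- Tangential traces of the `TM` modes at the argument `s`. -/
noncomputable def traceTM (n : ℕ) (m s : ℝ) : Matrix (Fin 2) (Fin 2) ℂ :=
  !![(calJ n s : ℂ) / (m : ℂ), calH n s / (m : ℂ); (sphJ n s : ℂ), sphH n s]

/-- The adjugate of `traceTM`. -/
noncomputable def adjTraceTM (n : ℕ) (m s : ℝ) : Matrix (Fin 2) (Fin 2) ℂ :=
  !![sphH n s, -(calH n s / (m : ℂ)); -(sphJ n s : ℂ), (calJ n s : ℂ) / (m : ℂ)]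

theorem exists_tendsto_transferTE {n : ℕ} (hn : 1 ≤ n) {m ζ ξ : ℝ} (hm : 0 < m) (hζ : 0 < ζ)
    (hζξ : ζ < ξ) : ∃ A : Matrix (Fin 2) (Fin 2) ℝ, IsCheckered A ∧ ∀ i k,
      Tendsto (fun t : ℝ => ((-Complex.I * (t : ℂ)) •
        (traceTE n m (t * ζ) * adjTraceTE n m (t * ξ))) i k) (𝓝[>] 0) (𝓝 (A i k)) := by
  obtain ⟨p, q, u, v, hp, hq, hu, hv, h1, h2, h3, h4⟩ := exists_crossProduct_limits hn hζ hζξ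
  have e1 := (tendsto_mul_const_nhdsGT_zero hζ).eventually (eventually_calH_eq n)
  have e2 := (tendsto_mul_const_nhdsGT_zero (hζ.trans hζξ)).eventually (eventually_calH_eq n)
  have hI := Complex.I_sq
  have hm0 : (m : ℂ) ≠ 0 := by exact_mod_cast hm.ne'
  refine ⟨!![p / m, q; u / (m * m), v / m], ⟨div_pos hp hm, hq,
    div_neg_of_neg_of_pos hu (mul_pos hm hm), div_pos hv hm⟩, fun i k => ?_⟩
  fin_cases i <;> fin_cases k
  · refine ((Complex.continuous_ofReal.tendsto _).comp (h1.div_const m)).congr' ?_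
    filter_upwards [e1, e2] with t ht1 ht2
    simp [traceTE, adjTraceTE, sphH, ht1, ht2]
    field_simp
    linear_combination ((t : ℂ) * (sphJ n (t * ζ) * calY n (t * ξ) -
      sphY n (t * ζ) * calJ n (t * ξ))) * hI
  · refine ((Complex.continuous_ofReal.tendsto _).comp h2).congr' ?_
    filter_upwards [e1, e2] with t ht1 ht2
    simp [traceTE, adjTraceTE, sphH, ht1, ht2]
    linear_combination ((t : ℂ) * (sphY n (t * ζ) * sphJ n (t * ξ) -
      sphJ n (t * ζ) * sphY n (t * ξ))) * hI
  · refine ((Complex.continuous_ofReal.tendsto _).comp (h3.div_const (m * m))).congr' ?_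
    filter_upwards [e1, e2] with t ht1 ht2
    simp [traceTE, adjTraceTE, sphH, ht1, ht2]
    field_simp
    linear_combination ((t : ℂ) * (calJ n (t * ζ) * calY n (t * ξ) -
      calY n (t * ζ) * calJ n (t * ξ))) * hI
  · refine ((Complex.continuous_ofReal.tendsto _).comp (h4.div_const m)).congr' ?_
    filter_upwards [e1, e2] with t ht1 ht2
    simp [traceTE, adjTraceTE, sphH, ht1, ht2]
    field_simp
    linear_combination ((t : ℂ) * (calY n (t * ζ) * sphJ n (t * ξ) -
      calJ n (t * ζ) * sphY n (t * ξ))) * hI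

/-- Swapping the rows of the trace matrix swaps the columns of its adjugate and changes its sign.
The TM transfer matrix is thus minus the TE one conjugated by the swap, and `i` in place of `-i`
absorbs the sign. -/
theorem exists_tendsto_transferTM {n : ℕ} (hn : 1 ≤ n) {m ζ ξ : ℝ} (hm : 0 < m) (hζ : 0 < ζ)
    (hζξ : ζ < ξ) : ∃ A : Matrix (Fin 2) (Fin 2) ℝ, IsCheckered A ∧ ∀ i k,
      Tendsto (fun t : ℝ => ((Complex.I * (t : ℂ)) •
        (traceTM n m (t * ζ) * adjTraceTM n m (t * ξ))) i k) (𝓝[>] 0) (𝓝 (A i k)) := by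
  obtain ⟨A, ⟨hp, hq, hu, hv⟩, hA⟩ := exists_tendsto_transferTE hn hm hζ hζξ
  refine ⟨!![A 1 1, A 1 0; A 0 1, A 0 0], ⟨hv, hu, hq, hp⟩, fun i k => ?_⟩
  fin_cases i <;> fin_cases k
  · refine (hA 1 1).congr fun t => ?_
    simp [traceTE, adjTraceTE, traceTM, adjTraceTM]
    ring
  · refine (hA 1 0).congr fun t => ?_
    simp [traceTE, adjTraceTE, traceTM, adjTraceTM]
    ring
  · refine (hA 0 1).congr fun t => ?_
    simp [traceTE, adjTraceTE, traceTM, adjTraceTM]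
    ring
  · refine (hA 0 0).congr fun t => ?_
    simp [traceTE, adjTraceTE, traceTM, adjTraceTM]
    ring

/-- Behaviour at `0⁺` of the outgoing mode and of its derivative trace. -/
theorem exists_tendsto_hankel {n : ℕ} (hn : 1 ≤ n) {ξ : ℝ} (hξ : 0 < ξ) :
    ∃ f g : ℝ, 0 < f ∧ g < 0 ∧
      Tendsto (fun t : ℝ => (t : ℂ) ^ (n + 1) * sphH n (t * ξ)) (𝓝[>] 0) (𝓝 (-Complex.I * f)) ∧
      Tendsto (fun t : ℝ => (t : ℂ) ^ (n + 1) * calH n (t * ξ)) (𝓝[>] 0) (𝓝 (-Complex.I * g)) := by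
  obtain ⟨a, b, ha, hb, hj, hJ, hy, hY⟩ := exists_bessel_limits n
  have hn0 : (0 : ℝ) < n := by exact_mod_cast hn
  have hξt := tendsto_mul_const_nhdsGT_zero hξ
  -- The regular part is `O(t^n)`, so `t^(n+1)` times it vanishes; only the singular part survives.
  have regular : ∀ {F : ℝ → ℝ} {A : ℝ},
      Tendsto (fun s => s ^ (-(n : ℤ)) * F s) (𝓝[>] 0) (𝓝 A) →
      Tendsto (fun t : ℝ => t ^ (n + 1) * F (t * ξ)) (𝓝[>] 0) (𝓝 0) := fun {F A} hF => by
    have h0 : Tendsto (fun t : ℝ => t ^ (2 * n + 1)) (𝓝[>] 0) (𝓝 0) := by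
      have : Tendsto (fun t : ℝ => t ^ (2 * n + 1)) (𝓝 0) (𝓝 (0 ^ (2 * n + 1))) :=
        (continuous_pow _).tendsto 0
      simpa using this.mono_left nhdsWithin_le_nhds
    have h := ((hF.comp hξt).mul h0).mul_const (ξ ^ n)
    simp only [mul_zero, zero_mul] at h
    refine h.congr' ?_
    filter_upwards [self_mem_nhdsWithin] with t ht
    have ht : 0 < t := ht
    simp only [Function.comp, zpow_neg, zpow_natCast]
    rw [mul_pow]
    field_simp
    ring
  have singular : ∀ {F : ℝ → ℝ} {B : ℝ},
      Tendsto (fun s => s ^ ((n : ℤ) + 1) * F s) (𝓝[>] 0) (𝓝 B) →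
      Tendsto (fun t : ℝ => t ^ (n + 1) * F (t * ξ)) (𝓝[>] 0) (𝓝 (B / ξ ^ (n + 1))) :=
    fun {F B} hF => by
      refine ((hF.comp hξt).div_const (ξ ^ (n + 1))).congr fun t => ?_
      simp only [Function.comp]
      rw [show (n : ℤ) + 1 = ((n + 1 : ℕ) : ℤ) by push_cast; rfl, zpow_natCast, mul_pow]
      field_simp
  have combine : ∀ {F G : ℝ → ℝ} {B : ℝ}, Tendsto F (𝓝[>] 0) (𝓝 0) →
      Tendsto G (𝓝[>] 0) (𝓝 B) →
      Tendsto (fun t => (F t : ℂ) + Complex.I * (G t : ℂ)) (𝓝[>] 0)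
        (𝓝 (-Complex.I * ((-B : ℝ) : ℂ))) := fun {F G B} hF hG => by
    have h := ((Complex.continuous_ofReal.tendsto _).comp hF).add
      (((Complex.continuous_ofReal.tendsto _).comp hG).const_mul Complex.I)
    rw [show -Complex.I * ((-B : ℝ) : ℂ) = ((0 : ℝ) : ℂ) + Complex.I * (B : ℂ) by
      push_cast; ring]
    exact h
  refine ⟨_, _, ?_, ?_, (combine (regular hj) (singular hy)).congr fun t => ?_,
    (combine (regular hJ) (singular hY)).congr' ?_⟩
  · rw [neg_div, neg_neg]
    positivity
  -- Here `n ≥ 1` matters: the limit for `𝒴_n` carries a factor `n`.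
  · exact neg_neg_of_pos (by positivity)
  · rw [sphH]
    push_cast
    ring
  · filter_upwards [hξt.eventually (eventually_calH_eq n)] with t ht
    rw [ht]
    push_cast
    ring

/-! ### Propagation through the layers and the leading coefficient -/

/-- Regrouping of a product of interface matrices `Q_j R_{j-1}` into transfer matrices
`R_j Q_j`: the sign pattern of the limit is propagated from the outermost to the innermost
interface. -/
theorem tendstoAlternating_orderedProd {L : ℕ} {c d : ℂ} {e : ℝ → ℂ}
    {M : ℝ → ℕ → Matrix (Fin 2) (Fin 2) ℂ} {Q R : ℕ → ℝ → Matrix (Fin 2) (Fin 2) ℂ}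
    {x : Fin 2 → ℂ}
    (hM : ∀ t j, j + 1 ≤ L → M t (j + 1) = Q (j + 1) t * R j t)
    (hT : ∀ j, j + 1 ≤ L → ∃ A : Matrix (Fin 2) (Fin 2) ℝ, IsCheckered A ∧ ∀ i k,
      Tendsto (fun t : ℝ => ((d * (t : ℂ)) • (R (j + 1) t * Q (j + 1) t)) i k)
        (𝓝[>] 0) (𝓝 (A i k)))
    (h0 : TendstoAlternating c (fun t => e t • (R 0 t).mulVec x)) :
    TendstoAlternating c (fun t =>
      (e t * (d * (t : ℂ)) ^ L) • (R L t * orderedProd (M t) L).mulVec x) := by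
  suffices H : ∀ j, j ≤ L → TendstoAlternating c (fun t =>
      (e t * (d * (t : ℂ)) ^ j) • (R j t * orderedProd (M t) j).mulVec x) from H L le_rfl
  intro j
  induction j with
  | zero => intro _; simpa [orderedProd] using h0
  | succ j ih =>
    intro hj
    obtain ⟨A, hA, hAT⟩ := hT j hj
    have h := (ih (by omega)).mulVec hA hAT
    convert h using 2 with t
    rw [orderedProd, hM t j hj, Matrix.smul_mulVec, Matrix.mulVec_smul, smul_smul,
      Matrix.mulVec_mulVec]
    congr 1
    · ring
    · simp only [Matrix.mul_assoc]

/-- A nonzero limit of `t^(n+1) p(t)` is the leading coefficient of every low-frequency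
expansion of `p`. -/
theorem lowFreqExpansion_of_tendsto {n : ℕ} {p : ℝ → ℂ} {c : ℂ} (hc : c ≠ 0)
    (h : Tendsto (fun t : ℝ => (t : ℂ) ^ (n + 1) * p t) (𝓝[>] 0) (𝓝 c)) :
    (∃ g : ℕ → ℂ, HasLowFreqExpansion n n p g) ∧
      ∀ (N : ℕ) (g : ℕ → ℂ), n ≤ N → HasLowFreqExpansion n N p g → g 0 ≠ 0 := by
  constructor
  · refine ⟨fun _ => c, ?_⟩
    simp only [HasLowFreqExpansion, Nat.sub_self, zero_add, Finset.range_one,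
      Finset.sum_singleton, mul_zero, pow_zero, mul_one]
    rw [isLittleO_one_iff]
    simpa using h.sub_const c
  · intro N g _ hg
    have h1 : Tendsto (fun t : ℝ => (t : ℂ) ^ (n + 1) * p t -
        ∑ l ∈ Finset.range (N - n + 1), g l * (t : ℂ) ^ (2 * l)) (𝓝[>] 0) (𝓝 0) := by
      -- The error scale is bounded, also when `N = n`, so the remainder tends to `0`.
      have hb : (fun t : ℝ => t ^ (2 * (N - n))) =O[𝓝[>] 0] (fun _ : ℝ => (1 : ℝ)) := by
        have : Tendsto (fun t : ℝ => t ^ (2 * (N - n))) (𝓝[>] 0) (𝓝 (0 ^ (2 * (N - n)))) :=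
          ((continuous_pow _).tendsto 0).mono_left nhdsWithin_le_nhds
        exact this.isBigO_one ℝ
      exact (isLittleO_one_iff ℝ).1 (IsLittleO.trans_isBigO hg hb)
    have h2 : Tendsto (fun t : ℝ => ∑ l ∈ Finset.range (N - n + 1), g l * (t : ℂ) ^ (2 * l))
        (𝓝[>] 0) (𝓝 (g 0)) := by
      have hcont : Continuous (fun t : ℝ =>
          ∑ l ∈ Finset.range (N - n + 1), g l * (t : ℂ) ^ (2 * l)) := by fun_prop
      have := (hcont.tendsto 0).mono_left (nhdsWithin_le_nhds (s := Set.Ioi 0))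
      simpa [Finset.sum_range_succ'] using this
    have h3 := h.sub h1
    simp only [sub_sub_cancel, sub_zero] at h3
    rw [tendsto_nhds_unique h2 h3]
    exact hc

/-! ### Application to layered media -/

namespace IsLayered

variable {L : ℕ} {r μ ε : ℕ → ℝ}

theorem mu_pos' (h : IsLayered L r μ ε) {j : ℕ} (hj : j ≤ L) : 0 < μ j := by
  rcases Nat.eq_zero_or_pos j with rfl | h0
  · rw [h.mu_zero]; exact one_pos
  · exact h.mu_pos j h0 hj

theorem eps_pos' (h : IsLayered L r μ ε) {j : ℕ} (hj : j ≤ L) : 0 < ε j := by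
  rcases Nat.eq_zero_or_pos j with rfl | h0
  · rw [h.eps_zero]; exact one_pos
  · exact h.eps_pos j h0 hj

theorem r_pos (h : IsLayered L r μ ε) {j : ℕ} (hj : j ≤ L) : 0 < r (j + 1) := by
  induction hj using Nat.decreasingInduction with
  | self => rw [h.r_last]; exact one_pos
  | of_succ k hk ih => exact ih.trans (h.r_lt (k + 1) (by omega) hk)

/-- The scaled radii `√(ε_j μ_j) r` at the two ends of a layer. -/
theorem scaled_radii (h : IsLayered L r μ ε) {j : ℕ} (hj : j + 1 ≤ L) :
    0 < √(ε (j + 1) * μ (j + 1)) * r (j + 2) ∧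
      √(ε (j + 1) * μ (j + 1)) * r (j + 2) < √(ε (j + 1) * μ (j + 1)) * r (j + 1) := by
  have hs : 0 < √(ε (j + 1) * μ (j + 1)) :=
    Real.sqrt_pos.2 (mul_pos (h.eps_pos' hj) (h.mu_pos' hj))
  exact ⟨mul_pos hs (h.r_pos hj), mul_lt_mul_of_pos_left (h.r_lt (j + 1) (by omega) hj) hs⟩

theorem exists_tendsto_pTE2 (h : IsLayered L r μ ε) {n : ℕ} (hn : 1 ≤ n) :
    ∃ c : ℂ, c ≠ 0 ∧
      Tendsto (fun t : ℝ => (t : ℂ) ^ (n + 1) * pTE2 n L r μ ε t) (𝓝[>] 0) (𝓝 c) := by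
  obtain ⟨f, g, hf, hg, hh, hH⟩ := exists_tendsto_hankel hn (ξ := 2) two_pos
  have key := tendstoAlternating_orderedProd (L := L) (c := -Complex.I) (d := -Complex.I)
    (e := fun t : ℝ => (t : ℂ) ^ (n + 1)) (M := interfaceTE n r μ ε) (x := ![0, 1])
    (Q := fun j t => adjTraceTE n (μ j) (t * (√(ε j * μ j) * r j)))
    (R := fun j t => traceTE n (μ j) (t * (√(ε j * μ j) * r (j + 1))))
    (fun t j _ => by
      simp only [interfaceTE, adjTraceTE, traceTE, waveNum, mul_assoc, Nat.add_sub_cancel])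
    (fun j hj => exists_tendsto_transferTE hn (h.mu_pos' hj) (h.scaled_radii hj).1
      (h.scaled_radii hj).2)
    -- The vector `![0, 1]` selects the outgoing column of `R_0`, evaluated at `2t` because `r 1 =
    -- 2` and `μ 0 = ε 0 = 1`.
    ⟨![f, g], hf, hg, fun i => by
      fin_cases i
      · refine hh.congr fun t => ?_
        simp [traceTE, h.mu_zero, h.eps_zero, h.r_one]
      · refine hH.congr fun t => ?_
        simp [traceTE, h.mu_zero, h.eps_zero, h.r_one]⟩
  obtain ⟨v, hv, -, hlim⟩ := key
  set C : ℝ := ∏ j ∈ Finset.Icc 1 L, μ j ^ (3 / 2 : ℝ) * ε j ^ (1 / 2 : ℝ) * r j with hC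
  have hCpos : 0 < C := Finset.prod_pos fun j hj => by
    obtain ⟨h1, h2⟩ := Finset.mem_Icc.1 hj
    obtain ⟨i, rfl⟩ := Nat.exists_eq_add_of_le' h1
    have := h.mu_pos' h2
    have := h.eps_pos' h2
    have := h.r_pos (j := i) (by omega)
    positivity
  refine ⟨C * (-Complex.I * v 0), ?_, ((hlim 0).const_mul (C : ℂ)).congr fun t => ?_⟩
  · simp [hCpos.ne', hv.ne']
  · simp only [pTE2, PTE, ← hC]
    generalize orderedProd _ L = W
    simp only [traceTE, waveNum, h.r_last, mul_one, Pi.smul_apply, Matrix.smul_apply,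
      Matrix.mulVec, dotProduct, Matrix.mul_apply, Fin.sum_univ_two, smul_eq_mul, Matrix.of_apply,
      Matrix.cons_val_zero, Matrix.cons_val_one, mul_zero, zero_add]
    ring

theorem exists_tendsto_pTM2 (h : IsLayered L r μ ε) {n : ℕ} (hn : 1 ≤ n) :
    ∃ c : ℂ, c ≠ 0 ∧
      Tendsto (fun t : ℝ => (t : ℂ) ^ (n + 1) * pTM2 n L r μ ε t) (𝓝[>] 0) (𝓝 c) := by
  obtain ⟨f, g, hf, hg, hh, hH⟩ := exists_tendsto_hankel hn (ξ := 2) two_pos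
  have key := tendstoAlternating_orderedProd (L := L) (c := Complex.I) (d := Complex.I)
    (e := fun t : ℝ => (t : ℂ) ^ (n + 1)) (M := interfaceTM n r μ ε) (x := ![0, 1])
    (Q := fun j t => adjTraceTM n (ε j) (t * (√(ε j * μ j) * r j)))
    (R := fun j t => traceTM n (ε j) (t * (√(ε j * μ j) * r (j + 1))))
    (fun t j _ => by
      simp only [interfaceTM, adjTraceTM, traceTM, waveNum, mul_assoc, Nat.add_sub_cancel])
    (fun j hj => exists_tendsto_transferTM hn (h.eps_pos' hj) (h.scaled_radii hj).1
      (h.scaled_radii hj).2)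
    -- The TM traces come in the opposite order; `-i(g, f) = i(-g, -f)` restores the signs `(+, -)`.
    ⟨![-g, -f], neg_pos.2 hg, neg_neg_of_pos hf, fun i => by
      fin_cases i
      · convert hH.congr fun t => ?_ using 2
        · simp
        · simp [traceTM, h.mu_zero, h.eps_zero, h.r_one]
      · convert hh.congr fun t => ?_ using 2
        · simp
        · simp [traceTM, h.mu_zero, h.eps_zero, h.r_one]⟩
  obtain ⟨v, hv, -, hlim⟩ := key
  set C : ℝ := ∏ j ∈ Finset.Icc 1 L, μ j ^ (1 / 2 : ℝ) * ε j ^ (3 / 2 : ℝ) * r j with hC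
  have hCpos : 0 < C := Finset.prod_pos fun j hj => by
    obtain ⟨h1, h2⟩ := Finset.mem_Icc.1 hj
    obtain ⟨i, rfl⟩ := Nat.exists_eq_add_of_le' h1
    have := h.mu_pos' h2
    have := h.eps_pos' h2
    have := h.r_pos (j := i) (by omega)
    positivity
  have hε : (ε L : ℂ) ≠ 0 := by exact_mod_cast (h.eps_pos' le_rfl).ne'
  -- The first row of `traceTM` carries `1 / ε L`, absent from the row in `PTM`.
  refine ⟨C * ε L * (Complex.I * v 0), ?_,
    ((hlim 0).const_mul ((C : ℂ) * ε L)).congr fun t => ?_⟩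
  · simp [hCpos.ne', hv.ne', hε]
  · simp only [pTM2, PTM, ← hC]
    generalize orderedProd _ L = W
    simp only [traceTM, waveNum, h.r_last, mul_one, Pi.smul_apply, Matrix.smul_apply,
      Matrix.mulVec, dotProduct, Matrix.mul_apply, Fin.sum_univ_two, smul_eq_mul, Matrix.of_apply,
      Matrix.cons_val_zero, Matrix.cons_val_one, mul_zero, zero_add]
    field_simp

end IsLayered

theorem lemma4p1 (L : ℕ) (r μ ε : ℕ → ℝ) (hlay : IsLayered L r μ ε) (n : ℕ) (hn : 1 ≤ n) :
    ((∃ g : ℕ → ℂ, HasLowFreqExpansion n n (pTE2 n L r μ ε) g) ∧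
      ∀ (N : ℕ) (g : ℕ → ℂ), n ≤ N →
        HasLowFreqExpansion n N (pTE2 n L r μ ε) g → g 0 ≠ 0) ∧
    ((∃ g : ℕ → ℂ, HasLowFreqExpansion n n (pTM2 n L r μ ε) g) ∧
      ∀ (N : ℕ) (g : ℕ → ℂ), n ≤ N →
        HasLowFreqExpansion n N (pTM2 n L r μ ε) g → g 0 ≠ 0) := by
  obtain ⟨c, hc, hTE⟩ := hlay.exists_tendsto_pTE2 hn
  obtain ⟨d, hd, hTM⟩ := hlay.exists_tendsto_pTM2 hn
  exact ⟨lowFreqExpansion_of_tendsto hc hTE, lowFreqExpansion_of_tendsto hd hTM⟩
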